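/- **Model.** Let $R$ be a finite set of resources, each with a cost function $c_r:\mathbb{R}_{\ge 0}\to\mathbb{R}_{\ge 0}$. Unweighted requests $1,\dots,n$ arrive online; request $i$ is a nonempty collection $\mathcal S_i\subseteq 2^R$ of feasible allocations, and on arrival some $S_i\in\mathcal S_i$ has to be fixed irrevocably, without knowledge of later requests. For an allocation vector $\vec S=(S_1,\dots,S_n)$ let $w_r(\vec S)=|\{j: r\in S_j\}|$ and $w_r(\vec S_{<i})=|\{j<i: r\in S_j\}|$; its total cost is $C(\vec S)=\sum_{i}\sum_{r\in S_i}c_r(w_r(\vec S))$, and $\mathrm{OPT}$ is the minimum of $C$ over all feasible allocation vectors. A best reply algorithm is an online algorithm that assigns to each arriving request $i$ an allocation $S_i\in\mathcal S_i$ minimizing the personal cost $\sum_{r\in S_i}c_r(w_r(\vec S_{<i})+1)$, with arbitrary tie-breaking. An online algorithm is $\rho$-competitive if $\sup \mathrm{ALG}/\mathrm{OPT}\le\rho$, where the supremum is over all finite sequences of unweighted requests with $\mathrm{OPT}>0$ and $\mathrm{ALG}$ is the total cost of the allocation vector that it produces. Let $W:\mathbb{R}_{\ge0}\to\mathbb{R}_{\ge0}$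 be the Lambert-W function, the inverse of $w\mapsto we^w$. **Theorem 1.** Let $d\ge 1$ be an integer. The equation $$d\left(2x e^{1/x} + x^2 - e^{2/x} - x^2 e^{1/x}\right) = e^{2/x}$$ has a unique solution $x=\Xi_d$ in the positive reals, and $$\Xi_d \le \frac{1}{W\left(\frac{1.2d-1}{d+1}\right)},\qquad\text{and, if } d\ge 2,\qquad \Xi_d \le \frac{1}{W\left(\frac{1.2d}{d+1}\right)}.$$ Every best reply algorithm is $d(\Xi_d d)^{d+1}$-competitive for unweighted resource allocation problems in which every cost function is a polynomial of degree at most $d$ with non-negative coefficients. -/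

import Mathlib

namespace ResourceAllocation

/-- A request: a positive weight and a nonempty collection of feasible allocations, each of which
is a set of resources. -/
structure Request (R : Type*) where
  weight : ℝ
  weight_pos : 0 < weight
  feasible : Set (Finset R)
  nonempty : feasible.Nonempty

section Model

variable {R : Type*} [DecidableEq R] {n : ℕ}

/-- The load of resource `r` under the allocation vector `S`: the total weight of the requests
that use `r`. -/
def load (σ : Fin n → Request R) (S : Fin n → Finset R) (r : R) : ℝ :=
  ∑ j : Fin n, if r ∈ S j then (σ j).weight else 0

/-- The load of resource `r` just before request `i` arrives. -/
def loadBefore (σ : Fin n → Request R) (S : Fin n → Finset R) (i : Fin n) (r : R) : ℝ :=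
  ∑ j : Fin n, if j < i ∧ r ∈ S j then (σ j).weight else 0

/-- The total cost of the allocation vector `S`. -/
def totalCost (c : R → ℝ → ℝ) (σ : Fin n → Request R) (S : Fin n → Finset R) : ℝ :=
  ∑ i : Fin n, ∑ r ∈ S i, (σ i).weight * c r (load σ S r)

/-- The optimal offline cost: the minimum of the total cost over all feasible allocation
vectors. -/
noncomputable def opt (c : R → ℝ → ℝ) (σ : Fin n → Request R) : ℝ :=
  sInf {x : ℝ | ∃ S : Fin n → Finset R, (∀ i, S i ∈ (σ i).feasible) ∧ totalCost c σ S = x}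

/-- The personal cost that request `i` would have upon its arrival with the allocation `T`, when
the earlier requests are allocated according to `S`. -/
def personalCost (c : R → ℝ → ℝ) (σ : Fin n → Request R) (S : Fin n → Finset R) (i : Fin n)
    (T : Finset R) : ℝ :=
  ∑ r ∈ T, (σ i).weight * c r (loadBefore σ S i r + (σ i).weight)

end Model

/-- A deterministic online algorithm: the allocation of the last request of a sequence is a
function of the requests up to and including that one. -/
structure OnlineAlgorithm (R : Type*) where
  choose : (m : ℕ) → (Fin (m + 1) → Request R) → Finset R
  choose_mem : ∀ (m : ℕ) (σ : Fin (m + 1) → Request R), choose m σ ∈ (σ (Fin.last m)).feasible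

/-- The allocation vector that the algorithm `A` produces on the sequence of requests `σ`. -/
def OnlineAlgorithm.run {R : Type*} (A : OnlineAlgorithm R) {n : ℕ} (σ : Fin n → Request R) :
    Fin n → Finset R :=
  fun i => A.choose i (fun j => σ (Fin.castLE i.isLt j))

/-- `A` is a best reply algorithm: every request gets a feasible allocation that minimizes its
personal cost upon arrival (ties are broken arbitrarily). -/
def IsBestReply {R : Type*} [DecidableEq R] (c : R → ℝ → ℝ) (A : OnlineAlgorithm R) : Prop :=
  ∀ (n : ℕ) (σ : Fin n → Request R) (i : Fin n), ∀ T ∈ (σ i).feasible,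
    personalCost c σ (A.run σ) i (A.run σ i) ≤ personalCost c σ (A.run σ) i T

/-- A sequence of requests is unweighted if all weights are equal to one. -/
def IsUnweighted {R : Type*} {n : ℕ} (σ : Fin n → Request R) : Prop :=
  ∀ i, (σ i).weight = 1

/-- The competitive ratio of `A` on unweighted instances: the supremum of `ALG(σ) / OPT(σ)` over
all finite unweighted sequences of requests `σ` with `OPT(σ) > 0`. -/
noncomputable def unweightedCompetitiveRatio {R : Type*} [DecidableEq R] (c : R → ℝ → ℝ)
    (A : OnlineAlgorithm R) : ENNReal :=
  ⨆ (n : ℕ) (σ : Fin n → Request R) (_ : IsUnweighted σ) (_ : 0 < opt c σ),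
    ENNReal.ofReal (totalCost c σ (A.run σ) / opt c σ)

/-- On nonnegative loads, `f` is a polynomial of degree at most `d` with nonnegative
coefficients. -/
def IsPolyCost (d : ℕ) (f : ℝ → ℝ) : Prop :=
  ∃ p : Polynomial ℝ, p.natDegree ≤ d ∧ (∀ k, 0 ≤ p.coeff k) ∧ ∀ x : ℝ, 0 ≤ x → f x = p.eval x

/-- The Lambert-W function on the nonnegative reals, i.e. the inverse of `w ↦ w * exp w`. -/
noncomputable def lambertW (z : ℝ) : ℝ :=
  Function.invFunOn (fun w : ℝ => w * Real.exp w) (Set.Ici 0) z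

/-- For `z ≥ 0`, `lambertW z` is the unique `w ≥ 0` with `w * exp w = z`. -/
theorem lambertW_eq_iff {z : ℝ} (hz : 0 ≤ z) (w : ℝ) :
    lambertW z = w ↔ 0 ≤ w ∧ w * Real.exp w = z := by
  have hmono : StrictMonoOn (fun w : ℝ => w * Real.exp w) (Set.Ici 0) := by
    intro a ha b _ hab
    have ha' : (0 : ℝ) ≤ a := ha
    exact mul_lt_mul'' hab (Real.exp_lt_exp.2 hab) ha' (Real.exp_pos a).le
  have hex : ∃ a ∈ Set.Ici (0 : ℝ), (fun w : ℝ => w * Real.exp w) a = z := by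
    have hc : ContinuousOn (fun w : ℝ => w * Real.exp w) (Set.Icc 0 z) := by fun_prop
    have h1 : (1 : ℝ) ≤ Real.exp z := Real.one_le_exp hz
    have hmem : z ∈ Set.Icc ((fun w : ℝ => w * Real.exp w) 0)
        ((fun w : ℝ => w * Real.exp w) z) := by
      refine ⟨by simpa using hz, ?_⟩
      change z ≤ z * Real.exp z
      nlinarith
    obtain ⟨a, ha, hae⟩ := intermediate_value_Icc hz hc hmem
    exact ⟨a, ha.1, hae⟩
  have hm : lambertW z ∈ Set.Ici (0 : ℝ) := Function.invFunOn_mem hex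
  have he : lambertW z * Real.exp (lambertW z) = z := Function.invFunOn_eq hex
  constructor
  · rintro rfl
    exact ⟨hm, he⟩
  · rintro ⟨hw, hwe⟩
    exact hmono.injOn hm hw (he.trans hwe.symm)

/-- The equation `d (2 x e^{1/x} + x² - e^{2/x} - x² e^{1/x}) = e^{2/x}`, whose unique positive
solution is `Ξ_d`. -/
def XiEquation (d : ℕ) (x : ℝ) : Prop :=
  (d : ℝ) * (2 * x * Real.exp (1 / x) + x ^ 2 - Real.exp (2 / x) - x ^ 2 * Real.exp (1 / x))
    = Real.exp (2 / x)

end ResourceAllocation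

namespace ResourceAllocation

open Real

/-! A smoothness argument. Let resource `r` have `x` users under best reply and `y` under a
competitor `T`. Its successive users paid `c_r(1), …, c_r(x)` on arrival, and a deviation to `T`
costs at most `c_r(x + 1)` per user of `T`. Summing the best reply inequalities gives `∑ r, ∑ k < x,
c_r(k + 1) ≤ ∑ r, y * c_r(x + 1)`. Adding `β` times the slack to the algorithm's cost reduces the
ratio `γ` to the per-resource inequality `IsSmooth β γ`, which is linear in the cost function and so
only needs checking on monomials.

The ratio obtained is `d * τ ^ (d + 1)` with `τ = 3 d / 2 + 1`; `Ξ_d` enters only through `τ ≤ Ξ_d *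
d` (`le_div_of_xiRatio_eq`). Uniqueness and all bounds on `Ξ_d` come from strict monotonicity of
`xiRatio`, evaluated at suitable points. -/

/-- In the variable `y = 1 / x`, the equation defining `Ξ_d` reads `xiRatio y = 1 + 1 / d`. -/
noncomputable def xiRatio (y : ℝ) : ℝ :=
  (2 * y * exp (-y) - exp (-y) + exp (-y) ^ 2) / y ^ 2

/-! ### The equation for `Ξ_d` and the lower bound on its solution -/

lemma xiEquation_iff {d : ℕ} (hd : 1 ≤ d) {x : ℝ} (hx : 0 < x) :
    XiEquation d x ↔ xiRatio (1 / x) = 1 + 1 / (d : ℝ) := by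
  have hd' : (0 : ℝ) < d := by exact_mod_cast hd
  have h2 : exp (2 / x) = exp (1 / x) ^ 2 := by
    rw [← Real.exp_nat_mul]; congr 1; push_cast; ring
  have hE := exp_pos (1 / x)
  unfold XiEquation xiRatio
  rw [h2, Real.exp_neg]
  generalize exp (1 / x) = E at *
  field_simp
  constructor <;> intro h <;> linarith

lemma xiRatio_strictAntiOn : StrictAntiOn xiRatio (Set.Ioi 0) := by
  have hder : ∀ y : ℝ, 0 < y → HasDerivAt xiRatio
      (exp (-y) * (-y - 2 * y ^ 2 - 2 * y * exp (-y) + 2 - 2 * exp (-y)) / y ^ 3) y := by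
    intro y hy
    have hu : HasDerivAt (fun y : ℝ => exp (-y)) (-exp (-y)) y := by
      simpa using (hasDerivAt_neg y).exp
    have h := ((((hasDerivAt_id y).const_mul 2).mul hu).sub hu).add (hu.pow 2)
    have h' := h.div ((hasDerivAt_id y).pow 2) (by simpa using hy.ne')
    refine (h'.congr_deriv ?_)
    simp only [id, Pi.mul_apply, Pi.pow_apply, Pi.add_apply, Pi.sub_apply]
    field_simp
    ring
  refine strictAntiOn_of_deriv_neg (convex_Ioi 0)
    (fun y hy => (hder y hy).continuousAt.continuousWithinAt) ?_
  intro y hy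
  rw [interior_Ioi] at hy
  have hy : 0 < y := hy
  rw [(hder y hy).deriv]
  have h1 : 1 - y ≤ exp (-y) := by linarith [Real.add_one_le_exp (-y)]
  refine div_neg_of_neg_of_pos (mul_neg_of_pos_of_neg (exp_pos _) ?_) (by positivity)
  -- Inserting `exp (-y) ≥ 1 - y` bounds the second factor by `-y`.
  nlinarith

lemma continuousOn_xiRatio : ContinuousOn xiRatio (Set.Ioi 0) := by
  unfold xiRatio
  refine ContinuousOn.div (by fun_prop) (by fun_prop) fun y hy => ?_
  have hy : 0 < y := hy
  positivity

/-- The lower end `0.3` of the bracket also settles the Lambert bound for `d = 1`. -/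
lemma exists_xiRatio_eq {d : ℕ} (hd : 1 ≤ d) :
    ∃ y : ℝ, 0.3 ≤ y ∧ xiRatio y = 1 + 1 / (d : ℝ) := by
  have hd' : (1 : ℝ) ≤ d := by exact_mod_cast hd
  have hq : 1 / (d : ℝ) ≤ 1 := by rw [div_le_one (by linarith)]; exact hd'
  have hq0 : 0 ≤ 1 / (d : ℝ) := by positivity
  have hlo : (2 : ℝ) ≤ xiRatio 0.3 := by
    have h1 : (0.7 : ℝ) ≤ exp (-0.3) := by linarith [Real.add_one_le_exp (-0.3 : ℝ)]
    unfold xiRatio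
    rw [le_div_iff₀ (by norm_num)]
    nlinarith
  have hhi : xiRatio 1 ≤ 1 := by
    have h1 : exp (-1) ≤ 1 / 2 := by
      rw [Real.exp_neg, inv_eq_one_div]
      exact one_div_le_one_div_of_le (by norm_num) (by linarith [Real.add_one_le_exp (1 : ℝ)])
    unfold xiRatio
    nlinarith [exp_pos (-1)]
  obtain ⟨y, hy, hye⟩ := intermediate_value_Icc' (by norm_num : (0.3 : ℝ) ≤ 1)
    (continuousOn_xiRatio.mono fun y hy => lt_of_lt_of_le (by norm_num) hy.1)
    (show 1 + 1 / (d : ℝ) ∈ Set.Icc (xiRatio 1) (xiRatio 0.3) from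
      ⟨by linarith, by linarith⟩)
  exact ⟨y, hy.1, hye⟩

lemma exp_le_taylor_four {v : ℝ} (h0 : 0 ≤ v) (h1 : v ≤ 1) :
    exp v ≤ 1 + v + v ^ 2 / 2 + v ^ 3 / 6 + v ^ 4 * (5 / 96) := by
  have h := Real.exp_bound' h0 h1 (n := 4) (by norm_num)
  simp only [Finset.sum_range_succ, Finset.sum_range_zero, Nat.factorial] at h
  norm_num at h
  linarith

lemma exp_neg_le_taylor {v : ℝ} (h0 : 0 ≤ v) (h1 : v ≤ 1) :
    exp (-v) ≤ 1 - v + v ^ 2 / 2 - v ^ 3 / 6 + v ^ 4 / 24 := by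
  have h := Real.exp_bound (x := -v) (by rwa [abs_neg, abs_of_nonneg h0]) (n := 6) (by norm_num)
  rw [abs_neg, abs_of_nonneg h0] at h
  simp only [Finset.sum_range_succ, Finset.sum_range_zero, Nat.factorial] at h
  have h' := (abs_le.1 h).2
  norm_num at h'
  have h5 : 0 ≤ v ^ 5 := by positivity
  have h6 : v ^ 6 ≤ v ^ 5 := pow_le_pow_of_le_one h0 h1 (by norm_num)
  have e3 : (-v) ^ 3 = -v ^ 3 := by ring
  have e5 : (-v) ^ 5 = -v ^ 5 := by ring
  rw [e3, e5] at h'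
  linarith

/-- The numerator is quadratic in `exp (-v)` and increasing between `exp (-v)` and its Taylor upper
bound `P`, so `P` may replace the exponential, leaving a polynomial inequality. -/
lemma xiRatio_le {v : ℝ} (h0 : 0 < v) (h1 : v ≤ 2 / 3) : xiRatio v ≤ 1 / v - 1 / 2 := by
  have hu := exp_neg_le_taylor h0.le (by linarith)
  have hl : 1 - v ≤ exp (-v) := by linarith [Real.add_one_le_exp (-v)]
  set P := 1 - v + v ^ 2 / 2 - v ^ 3 / 6 + v ^ 4 / 24 with hP
  have hmono : 2 * v * exp (-v) - exp (-v) + exp (-v) ^ 2 ≤ 2 * v * P - P + P ^ 2 := by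
    nlinarith [mul_nonneg (sub_nonneg.2 hu) (by linarith : 0 ≤ 2 * v - 1 + (P + exp (-v)))]
  have hpoly : 2 * v * P - P + P ^ 2 ≤ v - v ^ 2 / 2 := by
    have hq : 0 ≤ 1 / 6 - 7 / 24 * v + v ^ 2 / 6 - 5 / 72 * v ^ 3 + v ^ 4 / 72 - v ^ 5 / 576 := by
      have : v ^ 5 ≤ v ^ 4 := pow_le_pow_of_le_one h0.le (by linarith) (by norm_num)
      have h2 : 0 ≤ v ^ 4 := by positivity
      nlinarith [mul_nonneg (sq_nonneg v) (sub_nonneg.2 h1), sq_nonneg (v - 2 / 3)]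
    have : v - v ^ 2 / 2 - (2 * v * P - P + P ^ 2) = v ^ 3 *
        (1 / 6 - 7 / 24 * v + v ^ 2 / 6 - 5 / 72 * v ^ 3 + v ^ 4 / 72 - v ^ 5 / 576) := by
      rw [hP]; ring
    have := mul_nonneg (by positivity : 0 ≤ v ^ 3) hq
    linarith
  unfold xiRatio
  rw [div_le_iff₀ (by positivity)]
  have : (1 / v - 1 / 2) * v ^ 2 = v - v ^ 2 / 2 := by field_simp
  linarith

/-- At `v = d / (3 d / 2 + 1)` the bound `1 / v - 1 / 2` equals `1 + 1 / d` exactly; this is the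
origin of the threshold `tau`. -/
lemma le_div_of_xiRatio_eq {d : ℕ} (hd : 1 ≤ d) {y : ℝ} (hy : 0 < y)
    (h : xiRatio y = 1 + 1 / (d : ℝ)) : 3 / 2 * (d : ℝ) + 1 ≤ 1 / y * d := by
  have hd' : (1 : ℝ) ≤ d := by exact_mod_cast hd
  have hv0 : 0 < (d : ℝ) / (3 / 2 * d + 1) := by positivity
  have hv := xiRatio_le hv0 (by rw [div_le_iff₀ (by positivity)]; linarith)
  have he : 1 / ((d : ℝ) / (3 / 2 * d + 1)) - 1 / 2 = 1 + 1 / (d : ℝ) := by field_simp; ring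
  rw [he, ← h] at hv
  have hle := (xiRatio_strictAntiOn.le_iff_ge hv0 hy).1 hv
  rw [le_div_iff₀ (by positivity)] at hle
  rw [one_div, inv_mul_eq_div, le_div_iff₀ hy]
  linarith

/-! ### Lambert-W bounds -/

lemma lambertW_spec {z : ℝ} (hz : 0 ≤ z) : 0 ≤ lambertW z ∧ lambertW z * exp (lambertW z) = z :=
  (lambertW_eq_iff hz _).1 rfl

lemma lambertW_pos {z : ℝ} (hz : 0 < z) : 0 < lambertW z := by
  obtain ⟨h0, h1⟩ := lambertW_spec hz.le
  refine h0.lt_of_ne fun h => ?_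
  rw [← h] at h1
  simp at h1
  exact hz.ne h1

lemma lambertW_le_iff {z : ℝ} (hz : 0 ≤ z) {w : ℝ} (hw : 0 ≤ w) :
    lambertW z ≤ w ↔ z ≤ w * exp w := by
  obtain ⟨h0, h1⟩ := lambertW_spec hz
  constructor
  · intro h
    rw [← h1]
    exact mul_le_mul h (exp_le_exp.2 h) (exp_pos _).le hw
  · intro h
    by_contra! hlt
    have := mul_lt_mul'' hlt (exp_lt_exp.2 hlt) hw (exp_pos _).le
    linarith

lemma lambertW_mono {z z' : ℝ} (hz : 0 ≤ z) (h : z ≤ z') : lambertW z ≤ lambertW z' := by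
  obtain ⟨h0, h1⟩ := lambertW_spec (hz.trans h)
  exact (lambertW_le_iff hz h0).2 (h.trans h1.ge)

/-- With `w = W(z)` and `u = exp (-w)`, the identity `w = z u` turns `xiRatio w ≥ 1 + 1 / d` into `u
≥ 1 - 0.8 w`. This follows from the tangent to `exp (-w)` at `0.48`, a lower bound for `w` when `d ≥
2`. -/
lemma lambertW_le_of_xiRatio_eq {d : ℕ} (hd : 2 ≤ d) {y : ℝ} (hy : 0 < y)
    (h : xiRatio y = 1 + 1 / (d : ℝ)) : lambertW (1.2 * (d : ℝ) / ((d : ℝ) + 1)) ≤ y := by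
  have hd' : (2 : ℝ) ≤ d := by exact_mod_cast hd
  set z : ℝ := 1.2 * (d : ℝ) / ((d : ℝ) + 1) with hz
  have hz0 : 0 < z := by positivity
  have hz8 : 0.8 ≤ z := by rw [hz, le_div_iff₀ (by positivity)]; linarith
  obtain ⟨-, hwe⟩ := lambertW_spec hz0.le
  have hw0 := lambertW_pos hz0
  set w := lambertW z
  have hexp : exp (0.48 : ℝ) ≤ 1.62 :=
    (exp_le_taylor_four (by norm_num) (by norm_num)).trans (by norm_num)
  have hw : 0.48 ≤ w := by
    by_contra! hlt
    have := mul_lt_mul'' hlt (exp_lt_exp.2 hlt) hw0.le (exp_pos _).le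
    nlinarith
  have hu0 : (0.617 : ℝ) ≤ exp (-0.48) := by
    rw [Real.exp_neg, inv_eq_one_div, le_div_iff₀ (exp_pos _)]
    linarith
  have hu : 1 - 0.8 * w ≤ exp (-w) := by
    have e : exp (-w) = exp (-0.48) * exp (0.48 - w) := by rw [← Real.exp_add]; congr 1; ring
    rw [e]
    rcases le_or_gt (1.48 : ℝ) w with h1 | h1
    · have := mul_pos (exp_pos (-0.48)) (exp_pos (0.48 - w))
      linarith
    · have h2 : 1.48 - w ≤ exp (0.48 - w) := by linarith [Real.add_one_le_exp (0.48 - w)]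
      nlinarith [mul_le_mul hu0 h2 (by linarith) (exp_pos _).le]
  have hratio : xiRatio y ≤ xiRatio w := by
    have hzu : w = z * exp (-w) := by
      rw [← hwe, mul_assoc, ← Real.exp_add]; simp
    have hup := exp_pos (-w)
    rw [h]
    unfold xiRatio
    rw [le_div_iff₀ (by positivity)]
    have hq : (1 + 1 / (d : ℝ)) * z = 1.2 := by rw [hz]; field_simp
    have e1 : (1 + 1 / (d : ℝ)) * w ^ 2 = 1.2 * (w * exp (-w)) := by
      calc (1 + 1 / (d : ℝ)) * w ^ 2 = (1 + 1 / (d : ℝ)) * w * (z * exp (-w)) := by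
            rw [← hzu]; ring
        _ = ((1 + 1 / (d : ℝ)) * z) * (w * exp (-w)) := by ring
        _ = _ := by rw [hq]
    rw [e1]
    nlinarith [mul_nonneg hup.le (by linarith : 0 ≤ exp (-w) + 0.8 * w - 1)]
  exact (xiRatio_strictAntiOn.le_iff_ge hy hw0).1 hratio


lemma exp_two_thirds_le : exp (2 / 3 : ℝ) ≤ 1.95 :=
  (exp_le_taylor_four (by norm_num) (by norm_num)).trans (by norm_num)

/-- A chord bound for `exp` along `q ↦ 1 / (3 / 2 + a q)`, `0 ≤ q ≤ 1 / 2`. -/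
lemma exp_le_chord {v q e e' : ℝ} (hq0 : 0 ≤ q) (hq1 : q ≤ 1 / 2)
    (hv : v ≤ (1 - 2 * q) * (2 / 3) + 2 * q * e) (he : exp e ≤ e') :
    exp v ≤ (1 - 2 * q) * 1.95 + 2 * q * e' := by
  have hc := convexOn_exp.2 (Set.mem_univ (2 / 3 : ℝ)) (Set.mem_univ e)
    (by linarith : 0 ≤ 1 - 2 * q) (by linarith : 0 ≤ 2 * q) (by ring)
  simp only [smul_eq_mul] at hc
  have h1 := exp_le_exp.2 hv
  have h2 := mul_le_mul_of_nonneg_left exp_two_thirds_le (by linarith : 0 ≤ 1 - 2 * q)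
  have h3 := mul_le_mul_of_nonneg_left he (by linarith : 0 ≤ 2 * q)
  linarith

lemma add_one_pow_le_mul_exp {t : ℝ} (ht : 0 < t) {k d : ℕ} (hk : k ≤ d) :
    (t + 1) ^ k ≤ t ^ k * exp (d / t) := by
  have h1 : (1 / t + 1) ^ k ≤ exp (d / t) := by
    calc (1 / t + 1) ^ k ≤ exp (1 / t) ^ k :=
          pow_le_pow_left₀ (by positivity) (Real.add_one_le_exp _) k
      _ = exp (k / t) := by rw [← Real.exp_nat_mul]; congr 1; ring
      _ ≤ exp (d / t) := by
          refine exp_le_exp.2 (div_le_div_of_nonneg_right ?_ ht.le)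
          exact_mod_cast hk
  calc (t + 1) ^ k = t ^ k * (1 / t + 1) ^ k := by
        rw [← mul_pow]; congr 1; field_simp; ring
    _ ≤ _ := mul_le_mul_of_nonneg_left h1 (by positivity)

section Threshold

variable {d : ℕ}

/-- The threshold `3 d / 2 + 1`, a lower bound for `Ξ_d d`. -/
noncomputable def tau (d : ℕ) : ℝ := 3 / 2 * (d : ℝ) + 1

/-- The slope `1 / (d + 1) - 1 / (d τ)`. -/
noncomputable def slope (d : ℕ) : ℝ := 1 / ((d : ℝ) + 1) - 1 / (d * tau d)

lemma tau_pos : 0 < tau d := by unfold tau; positivity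

lemma slope_mul_ge (hd : 2 ≤ d) : 0.45 ≤ 3 / 2 * d * slope d := by
  have hd' : (2 : ℝ) ≤ d := by exact_mod_cast hd
  have e : 3 / 2 * d * slope d = 3 / 2 * (d / ((d : ℝ) + 1)) - 3 / 2 / (3 / 2 * d + 1) := by
    unfold slope tau; field_simp
  have h1 : 2 / 3 ≤ d / ((d : ℝ) + 1) := by rw [le_div_iff₀ (by positivity)]; linarith
  have h2 : 3 / 2 / (3 / 2 * (d : ℝ) + 1) ≤ 3 / 8 := by
    rw [div_le_iff₀ (by positivity)]; linarith
  rw [e]; linarith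

lemma slope_nonneg (hd : 2 ≤ d) : 0 ≤ slope d := by
  have h := slope_mul_ge hd
  have hd' : (2 : ℝ) ≤ d := by exact_mod_cast hd
  by_contra! hlt
  nlinarith

lemma tau_mul_slope_ge (hd : 2 ≤ d) : 3 / 2 - 3 / 2 * (1 / (d : ℝ)) ≤ tau d * slope d := by
  have hd' : (2 : ℝ) ≤ d := by exact_mod_cast hd
  have e : tau d * slope d = 3 / 2 - 1 / 2 * (1 / ((d : ℝ) + 1)) - 1 / d := by
    unfold slope tau; field_simp; ring
  have h1 : 1 / ((d : ℝ) + 1) ≤ 1 / d := one_div_le_one_div_of_le (by linarith) (by linarith)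
  rw [e]; linarith

lemma tau_add_one_mul_slope_ge (hd : 2 ≤ d) :
    3 / 2 - 11 / 12 * (1 / (d : ℝ)) ≤ (tau d + 1) * slope d := by
  have hd' : (2 : ℝ) ≤ d := by exact_mod_cast hd
  have e : (tau d + 1) * slope d =
      3 / 2 + 1 / 2 * (1 / ((d : ℝ) + 1)) - 1 / d - 1 / d * (1 / (3 / 2 * d + 1)) := by
    unfold slope tau; field_simp; ring
  have h1 : 2 / 3 * (1 / (d : ℝ)) ≤ 1 / ((d : ℝ) + 1) := by
    rw [mul_one_div, div_le_div_iff₀ (by positivity) (by positivity)]; linarith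
  have h2 : 1 / (3 / 2 * (d : ℝ) + 1) ≤ 1 / 4 := one_div_le_one_div_of_le (by norm_num) (by linarith)
  have h3 := mul_le_mul_of_nonneg_left h2 (by positivity : 0 ≤ 1 / (d : ℝ))
  rw [e]; linarith

lemma inv_le_half (hd : 2 ≤ d) : 1 / (d : ℝ) ≤ 1 / 2 :=
  one_div_le_one_div_of_le (by norm_num) (by exact_mod_cast hd)

lemma exp_div_tau_le (hd : 2 ≤ d) : exp (d / tau d) ≤ 1.95 - 0.6 * (1 / (d : ℝ)) := by
  have hd' : (2 : ℝ) ≤ d := by exact_mod_cast hd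
  have h := exp_le_chord (v := d / tau d) (q := 1 / (d : ℝ)) (e := 1 / 2) (e' := 1.65)
    (by positivity) (inv_le_half hd) ?_
    ((exp_le_taylor_four (by norm_num) (by norm_num)).trans (by norm_num))
  · linarith
  · unfold tau
    field_simp
    nlinarith

lemma exp_div_tau_add_one_le (hd : 2 ≤ d) :
    exp (d / (tau d + 1)) ≤ 1.95 - 0.914 * (1 / (d : ℝ)) := by
  have hd' : (2 : ℝ) ≤ d := by exact_mod_cast hd
  have h := exp_le_chord (v := d / (tau d + 1)) (q := 1 / (d : ℝ)) (e := 0.4) (e' := 1.493)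
    (by positivity) (inv_le_half hd) ?_
    ((exp_le_taylor_four (by norm_num) (by norm_num)).trans (by norm_num))
  · linarith
  · unfold tau
    field_simp
    nlinarith

lemma pow_mul_le_tau_pow (hd : 2 ≤ d) {k : ℕ} (hk : k ≤ d) {t : ℝ} (h0 : 0 ≤ t)
    (ht : t ≤ tau d + 1) : 0.51 * t ^ k ≤ tau d ^ k := by
  have h1 : t ^ k ≤ (tau d + 1) ^ k := pow_le_pow_left₀ h0 ht k
  have h2 := add_one_pow_le_mul_exp (tau_pos (d := d)) hk
  have h3 : exp (d / tau d) ≤ 1.95 := by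
    have : 0 ≤ 1 / (d : ℝ) := by positivity
    linarith [exp_div_tau_le hd]
  have h4 : 0 < tau d ^ k := pow_pos tau_pos k
  -- `0.51 * 1.95 < 1`.
  nlinarith [mul_le_mul_of_nonneg_left h3 h4.le]

lemma tau_pow_le (hd : 2 ≤ d) {k : ℕ} (hk : k ≤ d) : tau d ^ k ≤ tau d ^ d := by
  refine pow_le_pow_right₀ ?_ hk
  unfold tau
  have : (0 : ℝ) ≤ d := by positivity
  linarith

lemma pow_le_tau_pow_add (hd : 2 ≤ d) {k : ℕ} (hk : k ≤ d) {t : ℝ} (h0 : 0 ≤ t) :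
    t ^ k ≤ tau d ^ d + t ^ k * (t * slope d) := by
  have hm := slope_nonneg hd
  have htp := tau_pow_le hd hk
  have hq := inv_le_half hd
  have htk : 0 ≤ t ^ k := by positivity
  rcases le_total t (tau d) with h | h
  · have := pow_le_pow_left₀ h0 h k
    have : 0 ≤ t ^ k * (t * slope d) := by positivity
    linarith
  rcases le_total t (tau d + 1) with h' | h'
  · have h1 := pow_mul_le_tau_pow hd hk h0 h'
    have h2 : 0.49 ≤ t * slope d := by
      linarith [tau_mul_slope_ge hd, mul_le_mul_of_nonneg_right h hm]
    nlinarith [mul_le_mul_of_nonneg_left h2 htk]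
  · have h2 : 1 ≤ t * slope d := by
      linarith [tau_add_one_mul_slope_ge hd, mul_le_mul_of_nonneg_right h' hm]
    have := pow_pos (tau_pos (d := d)) d
    nlinarith [mul_le_mul_of_nonneg_left h2 htk]

/-- Below `τ - 1` the term `τ ^ d` suffices. Elsewhere `(t + 1) ^ k ≤ t ^ k * exp (d / a)` for a
lower bound `a` of `t`, and `τ ^ d` absorbs `t ^ k` up to `τ`, then `0.51 * t ^ k` up to `τ + 1`,
and is not needed beyond. -/
lemma add_one_pow_le_tau_pow_add (hd : 2 ≤ d) {k : ℕ} (hk : k ≤ d) {t : ℝ} (h0 : 0 ≤ t) :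
    (t + 1) ^ k ≤ tau d ^ d + t ^ k * (t * slope d + 1 / 2) := by
  have hd' : (2 : ℝ) ≤ d := by exact_mod_cast hd
  have hm := slope_nonneg hd
  have htp := tau_pow_le hd hk
  have hq := inv_le_half hd
  have hq0 : 0 ≤ 1 / (d : ℝ) := by positivity
  have htk : 0 ≤ t ^ k := by positivity
  have hexp : ∀ a : ℝ, 0 < a → a ≤ t → (t + 1) ^ k ≤ t ^ k * exp (d / a) := by
    intro a ha hat
    refine (add_one_pow_le_mul_exp (ha.trans_le hat) hk).trans ?_
    refine mul_le_mul_of_nonneg_left (exp_le_exp.2 ?_) htk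
    exact div_le_div_of_nonneg_left (by linarith) ha hat
  rcases le_total (t + 1) (tau d) with h | h
  · have := pow_le_pow_left₀ (by linarith) h k
    have : 0 ≤ t ^ k * (t * slope d + 1 / 2) := by positivity
    linarith
  have hmt := mul_le_mul_of_nonneg_right h hm
  rcases le_total t (tau d) with h' | h'
  · have h1 : 3 / 2 * (d : ℝ) ≤ t := by unfold tau at h; linarith
    have h2 := hexp (3 / 2 * d) (by positivity) h1
    have e : (d : ℝ) / (3 / 2 * d) = 2 / 3 := by field_simp
    rw [e] at h2
    have h3 := mul_le_mul_of_nonneg_left exp_two_thirds_le htk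
    have h4 : 0.45 ≤ t * slope d :=
      (slope_mul_ge hd).trans (mul_le_mul_of_nonneg_right h1 hm)
    have h5 := mul_le_mul_of_nonneg_left h4 htk
    have h6 := pow_le_pow_left₀ h0 h' k
    linarith
  rcases le_total t (tau d + 1) with h'' | h''
  · have h1 := pow_mul_le_tau_pow hd hk h0 h''
    have h2 := hexp _ tau_pos h'
    have h3 : exp (d / tau d) ≤ 0.51 + (t * slope d + 1 / 2) := by
      linarith [exp_div_tau_le hd, tau_mul_slope_ge hd, mul_le_mul_of_nonneg_right h' hm]
    have h4 := mul_le_mul_of_nonneg_left h3 htk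
    linarith
  · have h2 := hexp _ (by linarith [tau_pos (d := d)]) h''
    have h3 : exp (d / (tau d + 1)) ≤ t * slope d + 1 / 2 := by
      linarith [exp_div_tau_add_one_le hd, tau_add_one_mul_slope_ge hd,
        mul_le_mul_of_nonneg_right h'' hm]
    have h4 := mul_le_mul_of_nonneg_left h3 htk
    have := pow_pos (tau_pos (d := d)) d
    linarith

/-- The left side is convex in `s` and the right side affine, so the endpoints `s = 0` and `s = 1`
suffice. -/
lemma add_pow_le_tau_pow_add (hd : 2 ≤ d) {k : ℕ} (hk : k ≤ d) {t s : ℝ} (h0 : 0 ≤ t)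
    (hs0 : 0 ≤ s) (hs1 : s ≤ 1) :
    (t + s) ^ k ≤ tau d ^ d + t ^ k * (t * slope d + s / 2) := by
  have hc := (convexOn_pow k (𝕜 := ℝ)).2 (show t ∈ Set.Ici 0 from h0)
    (show t + 1 ∈ Set.Ici (0 : ℝ) from by simp; linarith)
    (by linarith : 0 ≤ 1 - s) hs0 (by ring)
  simp only [smul_eq_mul] at hc
  have e : (1 - s) * t + s * (t + 1) = t + s := by ring
  rw [e] at hc
  have h1 := mul_le_mul_of_nonneg_left (pow_le_tau_pow_add hd hk h0) (by linarith : 0 ≤ 1 - s)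
  have h2 := mul_le_mul_of_nonneg_left (add_one_pow_le_tau_pow_add hd hk h0) hs0
  linarith

end Threshold

/-! ### Smoothness of monomials -/

/-- The trapezoidal rule overestimates the integral of `t ^ k` over `[x, x + 1]`. -/
lemma two_mul_pow_sub_pow_le {x : ℝ} (hx : 0 ≤ x) (k : ℕ) :
    2 * ((x + 1) ^ (k + 1) - x ^ (k + 1)) ≤ (k + 1) * (x ^ k + (x + 1) ^ k) := by
  induction k with
  | zero => norm_num
  | succ k ih =>
    have h1 : x ^ k ≤ (x + 1) ^ k := pow_le_pow_left₀ hx (by linarith) k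
    have h2 := mul_le_mul_of_nonneg_left ih (by linarith : 0 ≤ (x + 1) + x)
    have h3 := mul_le_mul_of_nonneg_left h1 (by positivity : (0 : ℝ) ≤ k + 1)
    push_cast
    simp only [pow_succ] at h2 ⊢
    nlinarith

lemma le_sum_range_pow {k : ℕ} (hk : 1 ≤ k) (x : ℕ) :
    (x : ℝ) ^ (k + 1) / (k + 1) + (x : ℝ) ^ k / 2 ≤
      ∑ j ∈ Finset.range x, ((j : ℝ) + 1) ^ k := by
  induction x with
  | zero => simp [show k ≠ 0 by omega]
  | succ x ih =>
    rw [Finset.sum_range_succ]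
    have h := two_mul_pow_sub_pow_le (by positivity : (0 : ℝ) ≤ x) k
    have h' : (((x : ℝ) + 1) ^ (k + 1) - (x : ℝ) ^ (k + 1)) / (k + 1) ≤
        ((x : ℝ) ^ k + ((x : ℝ) + 1) ^ k) / 2 := by
      rw [div_le_div_iff₀ (by positivity) (by norm_num)]
      linarith
    rw [sub_div] at h'
    push_cast
    linarith

/-- Bounding the sum by the trapezoidal rule and dividing by `y ^ (k + 1)` leaves
`add_pow_le_tau_pow_add` at `t = x / y`, `s = 1 / y`; `slope` is chosen so that `β * slope d = β /
(d + 1) - 1`. -/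
lemma smooth_monomial {d : ℕ} (hd : 2 ≤ d) {k : ℕ} (hk : k ≤ d) (x y : ℕ) :
    (x : ℝ) * (x : ℝ) ^ k + d * tau d * (y * ((x : ℝ) + 1) ^ k -
      ∑ j ∈ Finset.range x, ((j : ℝ) + 1) ^ k) ≤ d * tau d ^ (d + 1) * (y * (y : ℝ) ^ k) := by
  have hd' : (2 : ℝ) ≤ d := by exact_mod_cast hd
  have hτ := tau_pos (d := d)
  have hβ : (d : ℝ) + 1 ≤ d * tau d := by unfold tau; nlinarith
  set β : ℝ := d * tau d with hβdef
  have hβ0 : 0 < β := by positivity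
  have hγ : (d : ℝ) * tau d ^ (d + 1) = β * tau d ^ d := by rw [hβdef]; ring
  have hτ1 : 1 ≤ tau d ^ d := one_le_pow₀ (by unfold tau; linarith)
  rw [hγ]
  have hx0 : (0 : ℝ) ≤ x := by positivity
  have hy0 : (0 : ℝ) ≤ y := by positivity
  -- The trapezoidal bound fails for `k = 0`, where its extra `1 / 2` is not available.
  rcases Nat.eq_zero_or_pos k with rfl | hk1
  · simp only [pow_zero, mul_one, Finset.sum_const, Finset.card_range, nsmul_eq_mul]
    have h1 := mul_le_mul_of_nonneg_left hτ1 (by positivity : 0 ≤ β * y)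
    nlinarith
  have hsum := mul_le_mul_of_nonneg_left (le_sum_range_pow hk1 x) hβ0.le
  have hk' : (k : ℝ) ≤ d := by exact_mod_cast hk
  have hslope : β * slope d = β / (d + 1) - 1 := by
    unfold slope; rw [← hβdef]; field_simp
  have hkd : 1 / ((d : ℝ) + 1) ≤ 1 / (k + 1) :=
    one_div_le_one_div_of_le (by positivity) (by linarith)
  have hxk : (x : ℝ) ^ (k + 1) * (β * slope d) ≤
      β * ((x : ℝ) ^ (k + 1) / (k + 1)) - (x : ℝ) ^ (k + 1) := by
    rw [hslope]
    have := mul_le_mul_of_nonneg_left hkd (by positivity : 0 ≤ β * (x : ℝ) ^ (k + 1))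
    linear_combination this
  have hmain : (y : ℝ) * ((x : ℝ) + 1) ^ k ≤ tau d ^ d * (y * (y : ℝ) ^ k) +
      ((x : ℝ) ^ (k + 1) * slope d + (x : ℝ) ^ k / 2) := by
    rcases Nat.eq_zero_or_pos y with rfl | hy
    · have := slope_nonneg hd
      simp
      positivity
    have hy1 : (1 : ℝ) ≤ y := by exact_mod_cast hy
    have h := add_pow_le_tau_pow_add hd hk (t := (x : ℝ) / y) (s := 1 / y) (by positivity)
      (by positivity) (by rw [div_le_one (by linarith)]; exact hy1)
    have h' := mul_le_mul_of_nonneg_left h (by positivity : 0 ≤ (y : ℝ) ^ (k + 1))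
    have e1 : (y : ℝ) ^ (k + 1) * ((x : ℝ) / y + 1 / y) ^ k = y * ((x : ℝ) + 1) ^ k := by
      rw [← add_div, div_pow]; field_simp; ring
    have e2 : (y : ℝ) ^ (k + 1) * (tau d ^ d + ((x : ℝ) / y) ^ k * (x / y * slope d + 1 / y / 2)) =
        tau d ^ d * (y * (y : ℝ) ^ k) + ((x : ℝ) ^ (k + 1) * slope d + (x : ℝ) ^ k / 2) := by
      rw [div_pow]; field_simp; ring
    rwa [e1, e2] at h'
  have h1 := mul_le_mul_of_nonneg_left hmain hβ0.le
  have e : (x : ℝ) * (x : ℝ) ^ k = (x : ℝ) ^ (k + 1) := by ring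
  rw [e]
  linarith

lemma smooth_monomial_one {k : ℕ} (hk : k ≤ 1) (x y : ℕ) :
    (x : ℝ) * (x : ℝ) ^ k + 3 * (y * ((x : ℝ) + 1) ^ k -
      ∑ j ∈ Finset.range x, ((j : ℝ) + 1) ^ k) ≤ 6.25 * (y * (y : ℝ) ^ k) := by
  have hx0 : (0 : ℝ) ≤ x := by positivity
  have hy0 : (0 : ℝ) ≤ y := by positivity
  interval_cases k
  · simp only [pow_zero, mul_one, Finset.sum_const, Finset.card_range, nsmul_eq_mul]
    linarith
  · have hsum := le_sum_range_pow le_rfl x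
    simp only [pow_one] at hsum ⊢
    norm_num at hsum
    rcases Nat.eq_zero_or_pos y with rfl | hy
    · push_cast
      nlinarith
    · have hy1 : (1 : ℝ) ≤ y := by exact_mod_cast hy
      nlinarith [sq_nonneg ((x : ℝ) - 3 * y + 3 / 2)]


/-! ### From smoothness to the competitive ratio -/

/-- Successive users of a resource meet loads `1, 2, …` on arrival; the induction removes the last
request, which does not affect earlier ones. -/
lemma sum_ite_count_eq_sum_range (g : ℝ → ℝ) : ∀ {n : ℕ} (P : Fin n → Prop) [DecidablePred P],
    (∑ i, if P i then g ((∑ j, if j < i ∧ P j then (1 : ℝ) else 0) + 1) else 0) =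
      ∑ k ∈ Finset.range (∑ j, if P j then 1 else 0), g (k + 1) := by
  intro n
  induction n with
  | zero => intro P _; simp
  | succ n ih =>
    intro P _
    have h := ih (fun i => P i.castSucc)
    simp only [Fin.sum_univ_castSucc, Fin.castSucc_lt_castSucc_iff, Fin.castSucc_lt_last, true_and,
      lt_irrefl, false_and, if_false, add_zero, not_lt_of_gt (Fin.castSucc_lt_last _)] at h ⊢
    rw [h]
    split_ifs with hP
    · rw [Finset.sum_range_succ]
      congr 3
      push_cast
      rfl
    · simp

lemma IsPolyCost.monotoneOn {d : ℕ} {f : ℝ → ℝ} (hf : IsPolyCost d f) :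
    MonotoneOn f (Set.Ici 0) := by
  obtain ⟨p, -, hp, he⟩ := hf
  intro a ha b hb hab
  rw [he a ha, he b hb, Polynomial.eval_eq_sum_range, Polynomial.eval_eq_sum_range]
  exact Finset.sum_le_sum fun k _ =>
    mul_le_mul_of_nonneg_left (pow_le_pow_left₀ ha hab k) (hp k)

/-- The smoothness inequality for the cost function `f`: `β` weights the best reply inequalities,
and `γ` is the resulting bound on the competitive ratio. -/
def IsSmooth (β γ : ℝ) (f : ℝ → ℝ) : Prop :=
  ∀ x y : ℕ, (x : ℝ) * f x + β * (y * f (x + 1) - ∑ k ∈ Finset.range x, f (k + 1)) ≤ γ * (y * f y)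

lemma IsPolyCost.isSmooth {d : ℕ} {f : ℝ → ℝ} (hf : IsPolyCost d f) {β γ : ℝ}
    (h : ∀ k ≤ d, IsSmooth β γ fun x => x ^ k) : IsSmooth β γ f := by
  obtain ⟨p, hd, hp, he⟩ := hf
  intro x y
  have hev : ∀ x : ℝ, 0 ≤ x → f x = ∑ k ∈ Finset.range (d + 1), p.coeff k * x ^ k := by
    intro x hx
    rw [he x hx, Polynomial.eval_eq_sum_range' (by omega : p.natDegree < d + 1)]
  have hsum : ∑ j ∈ Finset.range x, f (j + 1) =
      ∑ k ∈ Finset.range (d + 1), p.coeff k * ∑ j ∈ Finset.range x, ((j : ℝ) + 1) ^ k := by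
    simp only [Finset.mul_sum]
    rw [Finset.sum_comm]
    exact Finset.sum_congr rfl fun j _ => hev _ (by positivity)
  rw [hsum, hev x (by positivity), hev (x + 1) (by positivity), hev y (by positivity)]
  simp only [Finset.mul_sum, mul_sub, ← Finset.sum_sub_distrib, ← Finset.sum_add_distrib]
  refine Finset.sum_le_sum fun k hk => ?_
  have hk' : k ≤ d := by simpa [Nat.lt_succ_iff] using hk
  have := mul_le_mul_of_nonneg_left (h k hk' x y) (hp k)
  simp only [Finset.mul_sum, mul_sub, mul_add] at this
  convert this using 1
  · simp only [← Finset.mul_sum]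
    ring
  · ring

section Model

variable {R : Type*} [DecidableEq R] {n : ℕ}

/-- The number of requests that use the resource `r`. -/
def useCount (S : Fin n → Finset R) (r : R) : ℕ := ∑ j, if r ∈ S j then 1 else 0

lemma load_eq_useCount {σ : Fin n → Request R} (hσ : IsUnweighted σ) (S : Fin n → Finset R)
    (r : R) : load σ S r = useCount S r := by
  simp only [load, useCount, hσ _]
  push_cast
  rfl

lemma loadBefore_nonneg (σ : Fin n → Request R) (S : Fin n → Finset R) (i : Fin n) (r : R) :
    0 ≤ loadBefore σ S i r :=
  Finset.sum_nonneg fun j _ => by split_ifs <;> simp [(σ j).weight_pos.le]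

lemma loadBefore_le_load (σ : Fin n → Request R) (S : Fin n → Finset R) (i : Fin n) (r : R) :
    loadBefore σ S i r ≤ load σ S r := by
  refine Finset.sum_le_sum fun j _ => ?_
  have := (σ j).weight_pos.le
  by_cases h : r ∈ S j <;> by_cases h' : j < i <;> simp [h, h', this]

variable [Fintype R]

lemma sum_sum_mem_eq (S : Fin n → Finset R) (f : Fin n → R → ℝ) :
    ∑ i, ∑ r ∈ S i, f i r = ∑ r, ∑ i, if r ∈ S i then f i r else 0 := by
  rw [Finset.sum_comm]
  refine Finset.sum_congr rfl fun i _ => ?_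
  rw [← Finset.sum_filter]
  simp

lemma sum_sum_mem_const_eq (S : Fin n → Finset R) (f : R → ℝ) :
    ∑ i, ∑ r ∈ S i, f r = ∑ r, useCount S r * f r := by
  rw [sum_sum_mem_eq]
  refine Finset.sum_congr rfl fun r _ => ?_
  rw [useCount]
  push_cast
  rw [Finset.sum_mul]
  simp

lemma totalCost_eq {σ : Fin n → Request R} (hσ : IsUnweighted σ) (c : R → ℝ → ℝ)
    (S : Fin n → Finset R) :
    totalCost c σ S = ∑ r, useCount S r * c r (useCount S r) := by
  simp only [totalCost, hσ _, one_mul, load_eq_useCount hσ]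
  exact sum_sum_mem_const_eq S fun r => c r (useCount S r)

lemma sum_personalCost_self {σ : Fin n → Request R} (hσ : IsUnweighted σ) (c : R → ℝ → ℝ)
    (S : Fin n → Finset R) :
    ∑ i, personalCost c σ S i (S i) =
      ∑ r, ∑ k ∈ Finset.range (useCount S r), c r (k + 1) := by
  simp only [personalCost, hσ _, one_mul, loadBefore]
  rw [sum_sum_mem_eq S fun i r => c r ((∑ j, if j < i ∧ r ∈ S j then (1 : ℝ) else 0) + 1)]
  exact Finset.sum_congr rfl fun r _ => sum_ite_count_eq_sum_range (c r) fun i => r ∈ S i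

lemma sum_personalCost_le {σ : Fin n → Request R} (hσ : IsUnweighted σ) {c : R → ℝ → ℝ}
    (hc : ∀ r, MonotoneOn (c r) (Set.Ici 0)) (S T : Fin n → Finset R) :
    ∑ i, personalCost c σ S i (T i) ≤ ∑ r, useCount T r * c r (useCount S r + 1) := by
  rw [← sum_sum_mem_const_eq T fun r => c r (useCount S r + 1)]
  refine Finset.sum_le_sum fun i _ => Finset.sum_le_sum fun r _ => ?_
  rw [hσ i, one_mul, ← load_eq_useCount hσ]
  have h0 := loadBefore_nonneg σ S i r
  have h1 := loadBefore_le_load σ S i r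
  exact hc r (show (0 : ℝ) ≤ _ by linarith) (show (0 : ℝ) ≤ _ by linarith) (by linarith)

lemma totalCost_le_mul {σ : Fin n → Request R} (hσ : IsUnweighted σ) {c : R → ℝ → ℝ}
    (hc : ∀ r, MonotoneOn (c r) (Set.Ici 0)) {β γ : ℝ} (hβ : 0 ≤ β)
    (hsm : ∀ r, IsSmooth β γ (c r)) (S T : Fin n → Finset R)
    (hbr : ∀ i, personalCost c σ S i (S i) ≤ personalCost c σ S i (T i)) :
    totalCost c σ S ≤ γ * totalCost c σ T := by
  have h1 := (Finset.sum_le_sum fun i (_ : i ∈ Finset.univ) => hbr i).trans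
    (sum_personalCost_le hσ hc S T)
  rw [sum_personalCost_self hσ] at h1
  have h2 := Finset.sum_le_sum fun r (_ : r ∈ Finset.univ) => hsm r (useCount S r) (useCount T r)
  rw [Finset.sum_add_distrib, ← Finset.mul_sum, ← Finset.mul_sum, Finset.sum_sub_distrib] at h2
  rw [totalCost_eq hσ, totalCost_eq hσ]
  nlinarith

lemma unweightedCompetitiveRatio_le {c : R → ℝ → ℝ}
    (hc : ∀ r, MonotoneOn (c r) (Set.Ici 0)) {β γ : ℝ} (hβ : 0 ≤ β) (hγ : 0 < γ)
    (hsm : ∀ r, IsSmooth β γ (c r)) {A : OnlineAlgorithm R} (hA : IsBestReply c A) :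
    unweightedCompetitiveRatio c A ≤ ENNReal.ofReal γ := by
  refine iSup_le fun n => iSup_le fun σ => iSup_le fun hσ => iSup_le fun hopt => ?_
  refine ENNReal.ofReal_le_ofReal ?_
  rw [div_le_iff₀ hopt, ← div_le_iff₀' hγ]
  -- `OPT` is an infimum, so it suffices to compare with each feasible vector; nonemptiness of the
  -- requests supplies one.
  refine le_csInf ⟨_, fun i => (σ i).nonempty.some, fun i => (σ i).nonempty.some_mem, rfl⟩ ?_
  rintro _ ⟨T, hT, rfl⟩
  rw [div_le_iff₀' hγ]
  exact totalCost_le_mul hσ hc hβ hsm _ T fun i => hA n σ i (T i) (hT i)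

end Model

lemma exists_isSmooth {d : ℕ} (hd : 1 ≤ d) :
    ∃ β : ℝ, 0 ≤ β ∧ ∀ f, IsPolyCost d f → IsSmooth β (d * tau d ^ (d + 1)) f := by
  rcases hd.eq_or_lt with rfl | hd
  -- The estimates for general `d` assume `d ≥ 2`; here `γ = tau 1 ^ 2 = 6.25`.
  · refine ⟨3, by norm_num, fun f hf => hf.isSmooth fun k hk x y => ?_⟩
    have h := smooth_monomial_one hk x y
    have e : ((1 : ℕ) : ℝ) * tau 1 ^ (1 + 1) = 6.25 := by unfold tau; norm_num
    rw [e]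
    exact h
  · exact ⟨d * tau d, mul_nonneg (by positivity) tau_pos.le,
      fun f hf => hf.isSmooth fun k hk x y => smooth_monomial hd hk x y⟩

end ResourceAllocation

open ResourceAllocation in
theorem theorem1 (d : ℕ) (hd : 1 ≤ d) :
    ∃ Ξ : ℝ, (0 < Ξ ∧ XiEquation d Ξ ∧ ∀ x : ℝ, 0 < x → XiEquation d x → x = Ξ) ∧
      Ξ ≤ 1 / lambertW ((1.2 * (d : ℝ) - 1) / ((d : ℝ) + 1)) ∧
      (2 ≤ d → Ξ ≤ 1 / lambertW (1.2 * (d : ℝ) / ((d : ℝ) + 1))) ∧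
      ∀ (R : Type*) [Fintype R] [DecidableEq R] (c : R → ℝ → ℝ), (∀ r, IsPolyCost d (c r)) →
        ∀ A : OnlineAlgorithm R, IsBestReply c A →
          unweightedCompetitiveRatio c A ≤ ENNReal.ofReal ((d : ℝ) * (Ξ * (d : ℝ)) ^ (d + 1)) := by
  have hd' : (1 : ℝ) ≤ d := by exact_mod_cast hd
  obtain ⟨y, hy3, hy⟩ := exists_xiRatio_eq hd
  have hy0 : 0 < y := lt_of_lt_of_le (by norm_num) hy3
  have hz : 0 < (1.2 * (d : ℝ) - 1) / ((d : ℝ) + 1) := div_pos (by linarith) (by linarith)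
  refine ⟨1 / y, ⟨by positivity, ?_, ?_⟩, ?_, ?_, ?_⟩
  · rw [xiEquation_iff hd (by positivity), one_div_one_div, hy]
  · intro x hx h
    rw [xiEquation_iff hd hx, ← hy] at h
    rw [← xiRatio_strictAntiOn.injOn (show 1 / x ∈ Set.Ioi (0 : ℝ) from one_div_pos.2 hx) hy0 h,
      one_div_one_div]
  · refine one_div_le_one_div_of_le (lambertW_pos hz) ?_
    rcases hd.eq_or_lt with rfl | hd2
    · rw [lambertW_le_iff hz.le hy0.le]
      have : 1 ≤ Real.exp y := Real.one_le_exp hy0.le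
      norm_num
      nlinarith
    · refine (lambertW_mono hz.le ?_).trans (lambertW_le_of_xiRatio_eq hd2 hy0 hy)
      gcongr
      linarith
  · intro hd2
    exact one_div_le_one_div_of_le (lambertW_pos (by positivity))
      (lambertW_le_of_xiRatio_eq hd2 hy0 hy)
  · intro R _ _ c hc A hA
    obtain ⟨β, hβ, hsm⟩ := exists_isSmooth hd
    have hτ := tau_pos (d := d)
    refine (unweightedCompetitiveRatio_le (fun r => (hc r).monotoneOn) hβ (by positivity)
      (fun r => hsm _ (hc r)) hA).trans (ENNReal.ofReal_le_ofReal ?_)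
    have h := le_div_of_xiRatio_eq hd hy0 hy
    change tau d ≤ _ at h
    gcongr
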